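/- For every $\varepsilon_0 \in (0,1)$ there is a constant $c = c(\varepsilon_0) > 0$, depending only on $\varepsilon_0$, such that the following holds. Let $n, d, k \ge 1$ be integers, let $\|\cdot\|$ be any norm on $\mathbb{R}^k$, and let $\varepsilon$ satisfy $$\frac{\sqrt{\log n}}{\sqrt{d}} < \varepsilon \le \varepsilon_0 .$$ Suppose that for every set $X \subseteq \mathbb{R}^d$ of exactly $n$ points there exists a map $f_X \colon X \to \mathbb{R}^k$ with $$(1-\varepsilon)\,\|x-y\|_2 \;\le\; \|f_X(x)-f_X(y)\| \;\le\; (1+\varepsilon)\,\|x-y\|_2 \qquad \text{for all } x, y \in X .$$ Then $$k \;\ge\; c\,\frac{\log(\varepsilon^2 n)}{\varepsilon^{2}\,\log(1/\varepsilon)} .$$ -/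

import Mathlib

/-! For `ε ≤ 1/100` the bound comes from counting codes. Split a Euclidean space into `B ≈ ε⁻²`
blocks of dimension `t ≈ log (ε²n)`, and let `P` be a 1/2-separated 1/2-net of the unit ball of one
block, so `2^t ≤ |P| ≤ 5^t`. Base points put one net vector in one block; the `|P|^B` words put a
net vector in every block, scaled by `1/√B`. Distances to base points separate distinct words by
more than `8ε` (`exists_blockBase_separating`). Embed all base points together with equally many
arbitrary words and round the images to an `ε`-net of a ball of `N`. The rounded images determine
the words, so the number of words is at most the squared size of that net (`card_words_le`). This
gives `2^(Bt) ≤ (9/ε)^(2k)`, where `Bt` is of order `ε⁻² log (ε²n)`. For larger `ε`, the factor `ε²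
log (1/ε)` is bounded below and a packing argument giving `log n ≲ k` suffices (`log_le_of_embeds`).
-/

/-! ### Volumetric packing and covering bounds. -/

open MeasureTheory Metric Module in
/-- Volumetric bound for an `s`-separated subset of a ball of radius `R`. -/
theorem card_le_of_norm_separated {E : Type*} [NormedAddCommGroup E] [NormedSpace ℝ E]
    [FiniteDimensional ℝ E] {R s : ℝ} (hR : 0 ≤ R) (hs : 0 < s) (P : Finset E)
    (hP : ∀ x ∈ P, ‖x‖ ≤ R) (hsep : ∀ x ∈ P, ∀ y ∈ P, x ≠ y → s ≤ ‖x - y‖) :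
    (P.card : ℝ) ≤ (1 + 2 * R / s) ^ finrank ℝ E := by
  borelize E
  let μ : Measure E := Measure.addHaar
  have hδ : 0 < s / 2 := by positivity
  have hρ : 0 < R + s / 2 := by positivity
  have hdisj : Set.Pairwise (P : Set E) (Function.onFun Disjoint fun c => ball c (s / 2)) := by
    rintro c hc d hd hcd
    apply ball_disjoint_ball
    rw [dist_eq_norm, add_halves]
    exact hsep c hc d hd hcd
  have hsub : (⋃ c ∈ P, ball c (s / 2)) ⊆ ball (0 : E) (R + s / 2) := by
    refine Set.iUnion₂_subset fun x hx => ball_subset_ball' ?_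
    rw [dist_zero_right]
    linarith [hP x hx]
  have hvol : (P.card : ENNReal) * ENNReal.ofReal ((s / 2) ^ finrank ℝ E) * μ (ball 0 1) ≤
      ENNReal.ofReal ((R + s / 2) ^ finrank ℝ E) * μ (ball 0 1) :=
    calc
      _ = μ (⋃ c ∈ P, ball c (s / 2)) := by
        rw [measure_biUnion_finset hdisj fun c _ => measurableSet_ball]
        simp only [μ.addHaar_ball_of_pos _ hδ, Finset.sum_const, nsmul_eq_mul, mul_assoc]
      _ ≤ μ (ball (0 : E) (R + s / 2)) := measure_mono hsub
      _ = _ := by rw [μ.addHaar_ball_of_pos _ hρ]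
  have hvol' := (ENNReal.mul_le_mul_iff_left (measure_ball_pos μ _ zero_lt_one).ne'
    measure_ball_lt_top.ne).1 hvol
  have hreal := ENNReal.toReal_le_of_le_ofReal (pow_nonneg hρ.le _) hvol'
  rw [ENNReal.toReal_mul, ENNReal.toReal_natCast, ENNReal.toReal_ofReal (by positivity),
    ← le_div_iff₀ (by positivity), ← div_pow] at hreal
  have hratio : (R + s / 2) / (s / 2) = 1 + 2 * R / s := by
    field_simp
    ring
  rwa [hratio] at hreal

open Module in
/-- A ball of radius `R` has an `s`-separated subset which is also an `s`-net. -/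
theorem exists_separated_net (E : Type*) [NormedAddCommGroup E] [NormedSpace ℝ E]
    [FiniteDimensional ℝ E] {R s : ℝ} (hR : 0 ≤ R) (hs : 0 < s) :
    ∃ P : Finset E, (∀ x ∈ P, ‖x‖ ≤ R) ∧ (∀ x ∈ P, ∀ y ∈ P, x ≠ y → s ≤ ‖x - y‖) ∧
      ∀ x : E, ‖x‖ ≤ R → ∃ y ∈ P, ‖x - y‖ ≤ s := by
  classical
  let S : ℕ → Prop := fun m => ∃ P : Finset E, P.card = m ∧ (∀ x ∈ P, ‖x‖ ≤ R) ∧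
    ∀ x ∈ P, ∀ y ∈ P, x ≠ y → s ≤ ‖x - y‖
  let b := ⌊(1 + 2 * R / s) ^ finrank ℝ E⌋₊
  have hb : ∀ m, S m → m ≤ b := by
    rintro m ⟨P, rfl, h1, h2⟩
    exact Nat.le_floor (card_le_of_norm_separated hR hs P h1 h2)
  have h0 : S 0 := ⟨∅, by simp⟩
  -- A separated set of maximal size is a net: an uncovered point could be added to it.
  obtain ⟨P, hcard, h1, h2⟩ : S (Nat.findGreatest S b) := Nat.findGreatest_spec (Nat.zero_le b) h0
  refine ⟨P, h1, h2, fun x hx => ?_⟩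
  by_contra! hcon
  have hxP : x ∉ P := fun h => by
    have := hcon x h
    simp at this
    linarith
  have hS : S (P.card + 1) := by
    refine ⟨insert x P, Finset.card_insert_of_notMem hxP, ?_, ?_⟩
    · intro y hy
      rcases Finset.mem_insert.1 hy with rfl | hy
      · exact hx
      · exact h1 y hy
    · intro y hy z hz hyz
      rcases Finset.mem_insert.1 hy with hyx | hyP <;>
        rcases Finset.mem_insert.1 hz with hzx | hzP
      · exact absurd (hyx.trans hzx.symm) hyz
      · rw [hyx]
        exact (hcon z hzP).le
      · rw [hzx, norm_sub_rev]
        exact (hcon y hyP).le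
      · exact h2 y hyP z hzP hyz
  have := Nat.le_findGreatest (hb _ hS) hS
  omega

open MeasureTheory Metric Module in
/-- Volumetric lower bound for the cardinality of an `s`-net of a ball of radius `R`. -/
theorem le_card_of_net {E : Type*} [NormedAddCommGroup E] [NormedSpace ℝ E]
    [FiniteDimensional ℝ E] {R s : ℝ} (hR : 0 ≤ R) (hs : 0 < s) (P : Finset E)
    (hnet : ∀ x : E, ‖x‖ ≤ R → ∃ y ∈ P, ‖x - y‖ ≤ s) :
    (R / s) ^ finrank ℝ E ≤ (P.card : ℝ) := by
  borelize E
  let μ : Measure E := Measure.addHaar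
  have hsub : closedBall (0 : E) R ⊆ ⋃ c ∈ P, closedBall c s := by
    intro x hx
    obtain ⟨y, hy, hxy⟩ := hnet x (by simpa using hx)
    simp only [Set.mem_iUnion]
    exact ⟨y, hy, by simpa [dist_eq_norm] using hxy⟩
  have hvol : ENNReal.ofReal (R ^ finrank ℝ E) * μ (ball 0 1) ≤
      ((P.card : ENNReal) * ENNReal.ofReal (s ^ finrank ℝ E)) * μ (ball 0 1) :=
    calc
      _ = μ (closedBall 0 R) := by rw [μ.addHaar_closedBall _ hR]
      _ ≤ μ (⋃ c ∈ P, closedBall c s) := measure_mono hsub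
      _ ≤ ∑ c ∈ P, μ (closedBall c s) := measure_biUnion_finset_le _ _
      _ = _ := by
        simp only [μ.addHaar_closedBall _ hs.le, Finset.sum_const, nsmul_eq_mul, mul_assoc]
  have hvol' := (ENNReal.mul_le_mul_iff_left (measure_ball_pos μ _ zero_lt_one).ne'
    measure_ball_lt_top.ne).1 hvol
  have hreal := ENNReal.toReal_mono (by finiteness) hvol'
  rw [ENNReal.toReal_mul, ENNReal.toReal_natCast, ENNReal.toReal_ofReal (by positivity),
    ENNReal.toReal_ofReal (by positivity)] at hreal
  rw [div_pow, div_le_iff₀ (by positivity)]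
  exact hreal

open Module in
/-- Volumetric bound for sets separated with respect to a norm given as a seminorm. -/
theorem Seminorm.card_le_of_separated {E : Type*} [AddCommGroup E] [Module ℝ E]
    [FiniteDimensional ℝ E] (N : Seminorm ℝ E) (hN : ∀ v, N v = 0 → v = 0)
    {R s : ℝ} (hR : 0 ≤ R) (hs : 0 < s) (P : Finset E)
    (hP : ∀ x ∈ P, N x ≤ R) (hsep : ∀ x ∈ P, ∀ y ∈ P, x ≠ y → s ≤ N (x - y)) :
    (P.card : ℝ) ≤ (1 + 2 * R / s) ^ finrank ℝ E := by
  -- `E` carries no norm beforehand, so `N` itself can be installed as its norm.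
  let G : NormedAddCommGroup E := AddGroupNorm.toNormedAddCommGroup
    { toFun := N, map_zero' := map_zero N, add_le' := map_add_le_add N, neg' := map_neg_eq_map N
      eq_zero_of_map_eq_zero' := hN }
  let _ : NormedSpace ℝ E := { norm_smul_le := fun a b => (map_smul_eq_mul N a b).le }
  exact card_le_of_norm_separated (E := E) hR hs P hP hsep

open Module in
/-- Balls of a norm given as a seminorm have small `s`-nets. -/
theorem Seminorm.exists_net {E : Type*} [AddCommGroup E] [Module ℝ E]
    [FiniteDimensional ℝ E] (N : Seminorm ℝ E) (hN : ∀ v, N v = 0 → v = 0)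
    {R s : ℝ} (hR : 0 ≤ R) (hs : 0 < s) :
    ∃ P : Finset E, (P.card : ℝ) ≤ (1 + 2 * R / s) ^ finrank ℝ E ∧
      ∀ x : E, N x ≤ R → ∃ y ∈ P, N (x - y) ≤ s := by
  let G : NormedAddCommGroup E := AddGroupNorm.toNormedAddCommGroup
    { toFun := N, map_zero' := map_zero N, add_le' := map_add_le_add N, neg' := map_neg_eq_map N
      eq_zero_of_map_eq_zero' := hN }
  let _ : NormedSpace ℝ E := { norm_smul_le := fun a b => (map_smul_eq_mul N a b).le }
  obtain ⟨P, h1, h2, h3⟩ := exists_separated_net E hR hs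
  exact ⟨P, card_le_of_norm_separated hR hs P h1 h2, h3⟩

/-! ### Transferring configurations to `ℝ^d`. -/

open Module in
/-- A finite-dimensional Euclidean space embeds isometrically into `ℝ^d` for `d` at least its
dimension. -/
theorem exists_linearIsometry_euclideanSpace {V : Type*} [NormedAddCommGroup V]
    [InnerProductSpace ℝ V] [FiniteDimensional ℝ V] {d : ℕ} (h : finrank ℝ V ≤ d) :
    Nonempty (V →ₗᵢ[ℝ] EuclideanSpace ℝ (Fin d)) := by
  let b := stdOrthonormalBasis ℝ V
  let e := EuclideanSpace.basisFun (Fin d) ℝ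
  let L : V →ₗ[ℝ] EuclideanSpace ℝ (Fin d) :=
    b.toBasis.constr ℝ (fun i => e (Fin.castLE h i))
  have hL : L ∘ b.toBasis = e ∘ Fin.castLE h := by
    ext1 i
    simp [L]
  refine ⟨L.isometryOfOrthonormal (v := b.toBasis) (by simp [b.orthonormal]) ?_⟩
  rw [hL]
  exact e.orthonormal.comp _ (Fin.castLE_injective h)

/-- If all `n`-point subsets of `E` embed into `W` with prescribed distance bounds, then so do
all families of at most `n` points. -/
theorem exists_embedding_of_family {E W : Type*} [NormedAddCommGroup E] [Infinite E]
    [AddCommGroup W] {N : W → ℝ} {lo hi : ℝ} {n : ℕ}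
    (H : ∀ X : Finset E, X.card = n → ∃ f : {x : E // x ∈ X} → W, ∀ x y : {x : E // x ∈ X},
      lo * ‖(x : E) - (y : E)‖ ≤ N (f x - f y) ∧ N (f x - f y) ≤ hi * ‖(x : E) - (y : E)‖)
    {ι : Type*} [Fintype ι] (hι : Fintype.card ι ≤ n) (g : ι → E) :
    ∃ f : ι → W, ∀ i j, lo * ‖g i - g j‖ ≤ N (f i - f j) ∧ N (f i - f j) ≤ hi * ‖g i - g j‖ := by
  classical
  -- Pad the image of `g` to exactly `n` points; repetitions in `g` do no harm.
  obtain ⟨X, hX, hcard⟩ := Infinite.exists_superset_card_eq (Finset.univ.image g) n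
    (Finset.card_image_le.trans (by simpa using hι))
  obtain ⟨f, hf⟩ := H X hcard
  have hmem : ∀ i, g i ∈ X := fun i => hX (Finset.mem_image_of_mem g (Finset.mem_univ i))
  exact ⟨fun i => f ⟨g i, hmem i⟩, fun i j => hf ⟨g i, hmem i⟩ ⟨g j, hmem j⟩⟩

/-! ### The encoding argument. -/

open Module in
/-- Encoding bound: if the words `w a` in the unit ball are told apart by their distances to the
base points `r i`, and all families consisting of the base points and as many words embed into
`W` with distortion `ε`, then there are few words. -/
theorem card_words_le {V W : Type*} [NormedAddCommGroup V] [AddCommGroup W] [Module ℝ W]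
    [FiniteDimensional ℝ W] (N : Seminorm ℝ W) (hN : ∀ v, N v = 0 → v = 0)
    {ε : ℝ} (hε : 0 < ε) (hε1 : ε ≤ 1)
    {ι α : Type*} [Fintype ι] [Nonempty ι] [Fintype α] (r : ι → V) (w : α → V)
    (hr : ∀ i, ‖r i‖ ≤ 1) (hw : ∀ a, ‖w a‖ ≤ 1)
    (hsep : ∀ a a', a ≠ a' → ∃ i, 8 * ε < |‖w a - r i‖ - ‖w a' - r i‖|)
    (H : ∀ g : ι ⊕ ι → V, ∃ f : ι ⊕ ι → W, ∀ i j,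
      (1 - ε) * ‖g i - g j‖ ≤ N (f i - f j) ∧ N (f i - f j) ≤ (1 + ε) * ‖g i - g j‖) :
    (Fintype.card α : ℝ) ≤ ((9 / ε) ^ finrank ℝ W) ^ 2 := by
  classical
  -- Encoding as many words as base points spreads the cost of the base points: two net points are
  -- spent per word.
  let g : (ι → α) → ι ⊕ ι → V := fun c => Sum.elim r (fun i => w (c i))
  have hg : ∀ c x, ‖g c x‖ ≤ 1 := by
    rintro c (i | i)
    · exact hr i
    · exact hw _
  have hg2 : ∀ c x y, ‖g c x - g c y‖ ≤ 2 := fun c x y =>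
    (norm_sub_le _ _).trans (by linarith [hg c x, hg c y])
  choose f hf using fun c => H (g c)
  obtain ⟨A, hA, hnet⟩ := N.exists_net hN (R := 4) (s := ε) (by norm_num) hε
  -- Embeddings matter only up to translation; anchoring at `x₀` puts every image in one ball of
  -- radius `4 ≥ 2(1 + ε)`.
  let x₀ : ι ⊕ ι := Sum.inl (Classical.arbitrary ι)
  have hball : ∀ c x, N (f c x - f c x₀) ≤ 4 := fun c x => by
    have h1 := (hf c x x₀).2
    have h2 := hg2 c x x₀
    nlinarith [norm_nonneg (g c x - g c x₀)]
  choose ρ hρA hρ using fun c x => hnet _ (hball c x)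
  let code : (ι → α) → ι ⊕ ι → A := fun c x => ⟨ρ c x, hρA c x⟩
  have hinj : Function.Injective code := by
    intro c c' hcc
    have hρeq : ∀ x, ρ c x = ρ c' x := fun x => congrArg Subtype.val (congrFun hcc x)
    by_contra hne
    obtain ⟨j, hj⟩ := Function.ne_iff.1 hne
    have hclose : ∀ x, N ((f c x - f c x₀) - (f c' x - f c' x₀)) ≤ 2 * ε := fun x => by
      have h1 := hρ c x
      have h2 := hρ c' x
      rw [← hρeq x] at h2
      have h3 := map_sub_le_add N (f c x - f c x₀ - ρ c x) (f c' x - f c' x₀ - ρ c x)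
      rw [sub_sub_sub_cancel_right] at h3
      linarith
    have hdist : ∀ x y, |N (f c x - f c y) - N (f c' x - f c' y)| ≤ 4 * ε := fun x y => by
      have h1 := abs_sub_map_le_sub N (f c x - f c y) (f c' x - f c' y)
      have h2 := map_sub_le_add N ((f c x - f c x₀) - (f c' x - f c' x₀))
        ((f c y - f c x₀) - (f c' y - f c' x₀))
      have h3 : (f c x - f c x₀) - (f c' x - f c' x₀) - ((f c y - f c x₀) - (f c' y - f c' x₀)) =
        f c x - f c y - (f c' x - f c' y) := by abel
      rw [h3] at h2
      linarith [hclose x, hclose y]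
    obtain ⟨i, hi⟩ := hsep _ _ hj
    have h := hf c (Sum.inr j) (Sum.inl i)
    have h' := hf c' (Sum.inr j) (Sum.inl i)
    have hd := hdist (Sum.inr j) (Sum.inl i)
    have h2 := hg2 c (Sum.inr j) (Sum.inl i)
    have h2' := hg2 c' (Sum.inr j) (Sum.inl i)
    simp only [g, Sum.elim_inl, Sum.elim_inr] at h h' h2 h2'
    rw [abs_le] at hd
    -- Rounding contributes `4ε`, and distortion of distances at most 2 contributes `2ε` for each
    -- family: `8ε` in total.
    rcases lt_abs.1 hi with hi | hi <;> nlinarith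
  have hcard := Fintype.card_le_of_injective code hinj
  simp only [Fintype.card_fun, Fintype.card_sum, Fintype.card_coe] at hcard
  have hpow : Fintype.card α ^ Fintype.card ι ≤ (A.card ^ 2) ^ Fintype.card ι := by
    rwa [← pow_mul, two_mul]
  have hle := (Nat.pow_le_pow_iff_left Fintype.card_ne_zero).1 hpow
  have hA' : (A.card : ℝ) ≤ (9 / ε) ^ finrank ℝ W := by
    refine hA.trans (pow_le_pow_left₀ (by positivity) ?_ _)
    rw [show (9 : ℝ) / ε = 1 / ε + 2 * 4 / ε by ring]
    have := (one_le_div hε).2 hε1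
    linarith
  calc (Fintype.card α : ℝ) ≤ (A.card : ℝ) ^ 2 := by exact_mod_cast hle
    _ ≤ _ := by gcongr

/-! ### The block construction. -/

open scoped RealInnerProductSpace

/-- A unit-ball net contains a vector strongly correlated with any given direction. -/
theorem exists_mem_net_inner_ge {F : Type*} [NormedAddCommGroup F] [InnerProductSpace ℝ F]
    {P : Finset F} (hnet : ∀ x : F, ‖x‖ ≤ 1 → ∃ y ∈ P, ‖x - y‖ ≤ 1 / 2) {u : F} (hu : u ≠ 0) :
    ∃ p ∈ P, ‖u‖ / 2 ≤ ⟪u, p⟫ := by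
  have hpos : 0 < ‖u‖ := norm_pos_iff.2 hu
  have hunit : ‖‖u‖⁻¹ • u‖ = 1 := norm_smul_inv_norm (𝕜 := ℝ) hu
  obtain ⟨p, hp, hup⟩ := hnet (‖u‖⁻¹ • u) hunit.le
  refine ⟨p, hp, ?_⟩
  have hsplit : ⟪u, p⟫ = ‖u‖ - ⟪u, ‖u‖⁻¹ • u - p⟫ := by
    rw [inner_sub_right, inner_smul_right, real_inner_self_eq_norm_sq]
    field_simp
    ring
  have := real_inner_le_norm u (‖u‖⁻¹ • u - p)
  nlinarith

/-- The base points of the block construction: one net vector placed in one block. -/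
noncomputable def blockBase {F : Type*} [NormedAddCommGroup F] (P : Finset F) (B : ℕ)
    (i : Fin B × P) : PiLp 2 (fun _ : Fin B => F) :=
  PiLp.single 2 i.1 (i.2 : F)

/-- The words of the block construction: a net vector in every block, normalised. -/
noncomputable def blockWord {F : Type*} [NormedAddCommGroup F] [InnerProductSpace ℝ F]
    (P : Finset F) (B : ℕ) (a : Fin B → P) : PiLp 2 (fun _ : Fin B => F) :=
  WithLp.toLp 2 (fun b => (Real.sqrt B)⁻¹ • (a b : F))

theorem norm_blockBase_le {F : Type*} [NormedAddCommGroup F] {P : Finset F} {B : ℕ}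
    (hP : ∀ x ∈ P, ‖x‖ ≤ 1) (i : Fin B × P) : ‖blockBase P B i‖ ≤ 1 := by
  rw [blockBase, PiLp.norm_single]
  exact hP _ i.2.2

theorem norm_blockWord_le {F : Type*} [NormedAddCommGroup F] [InnerProductSpace ℝ F]
    {P : Finset F} {B : ℕ} (hP : ∀ x ∈ P, ‖x‖ ≤ 1) (a : Fin B → P) : ‖blockWord P B a‖ ≤ 1 := by
  rw [← sq_le_one_iff₀ (norm_nonneg _), PiLp.norm_sq_eq_of_L2]
  rcases Nat.eq_zero_or_pos B with rfl | hB
  · simp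
  have hB' : (0 : ℝ) < B := by exact_mod_cast hB
  calc ∑ b, ‖blockWord P B a b‖ ^ 2 ≤ ∑ _b : Fin B, (B : ℝ)⁻¹ := by
        refine Finset.sum_le_sum fun b _ => ?_
        have h1 := hP _ (a b).2
        simp only [blockWord, norm_smul, mul_pow, norm_inv, Real.norm_eq_abs, sq_abs, inv_pow]
        rw [Real.sq_sqrt hB'.le]
        exact mul_le_of_le_one_right (by positivity) (pow_le_one₀ (norm_nonneg _) h1)
    _ = 1 := by
        simp [hB'.ne']

/-- Two different words are told apart by their distances to some base point. -/
theorem exists_blockBase_separating {F : Type*} [NormedAddCommGroup F] [InnerProductSpace ℝ F]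
    {P : Finset F} {B : ℕ} (hP : ∀ x ∈ P, ‖x‖ ≤ 1)
    (hsep : ∀ x ∈ P, ∀ y ∈ P, x ≠ y → 1 / 2 ≤ ‖x - y‖)
    (hnet : ∀ x : F, ‖x‖ ≤ 1 → ∃ y ∈ P, ‖x - y‖ ≤ 1 / 2)
    {ε : ℝ} (hε : 0 < ε) (hB : (64 * ε) ^ 2 * B < 1) (a a' : Fin B → P) (h : a ≠ a') :
    ∃ i, 8 * ε < |‖blockWord P B a - blockBase P B i‖ - ‖blockWord P B a' - blockBase P B i‖| := by
  -- With this order the difference of squared norms has the favourable sign, leaving only inner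
  -- products to compare.
  wlog hle : ‖blockWord P B a'‖ ≤ ‖blockWord P B a‖ generalizing a a'
  · obtain ⟨i, hi⟩ := this a' a h.symm (not_le.1 hle).le
    exact ⟨i, by rwa [abs_sub_comm]⟩
  obtain ⟨b, hb⟩ := Function.ne_iff.1 h
  have hne : (a' b : F) ≠ a b := fun h => hb (Subtype.ext h.symm)
  obtain ⟨p, hp, hup⟩ := exists_mem_net_inner_ge hnet (sub_ne_zero.2 hne)
  have hhalf := hsep _ (a' b).2 _ (a b).2 hne
  have hB0 : (0 : ℝ) < B := by exact_mod_cast b.pos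
  have hsq : 0 < Real.sqrt B := Real.sqrt_pos.2 hB0
  have hq : 64 * ε < (Real.sqrt B)⁻¹ := by
    rw [lt_inv_comm₀ (by positivity) hsq, ← one_div]
    refine (Real.sqrt_lt' (by positivity)).2 ?_
    rw [div_pow, lt_div_iff₀ (by positivity)]
    linarith
  refine ⟨(b, ⟨p, hp⟩), lt_of_lt_of_le ?_ (le_abs_self _)⟩
  set r := blockBase P B (b, ⟨p, hp⟩) with hr
  have hr1 : ‖r‖ ≤ 1 := norm_blockBase_le hP _
  have hw := norm_blockWord_le (B := B) hP a
  have hw' := norm_blockWord_le (B := B) hP a'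
  have hinner : ⟪blockWord P B a', r⟫ - ⟪blockWord P B a, r⟫ =
      (Real.sqrt B)⁻¹ * ⟪(a' b : F) - a b, p⟫ := by
    have key : ∀ c : Fin B → P, ⟪blockWord P B c, r⟫ = (Real.sqrt B)⁻¹ * ⟪(c b : F), p⟫ := by
      intro c
      rw [PiLp.inner_apply, Finset.sum_eq_single b]
      · simp [hr, blockBase, blockWord, real_inner_smul_left]
      · intro b' _ hb'
        simp [hr, blockBase, hb']
      · simp
    rw [key, key, inner_sub_left]
    ring
  have e1 := norm_sub_sq_real (blockWord P B a) r
  have e2 := norm_sub_sq_real (blockWord P B a') r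
  have h1 : ‖blockWord P B a - r‖ ≤ 2 := (norm_sub_le _ _).trans (by linarith)
  have h2 : ‖blockWord P B a' - r‖ ≤ 2 := (norm_sub_le _ _).trans (by linarith)
  have hsqle : ‖blockWord P B a'‖ ^ 2 ≤ ‖blockWord P B a‖ ^ 2 := by gcongr
  have hgap : 16 * ε < (Real.sqrt B)⁻¹ * ⟪(a' b : F) - a b, p⟫ := by
    have : (Real.sqrt B)⁻¹ * (1 / 4) ≤ (Real.sqrt B)⁻¹ * ⟪(a' b : F) - a b, p⟫ := by
      gcongr
      linarith
    linarith
  -- The squared distances differ by more than `32ε`, while the distances sum to at most 4.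
  by_contra! hcon
  nlinarith [norm_nonneg (blockWord P B a - r), norm_nonneg (blockWord P B a' - r)]

open Module in
/-- The block construction bounds the target dimension: `B` blocks of dimension `t` give
`2 ^ (B t) ≤ (9 / ε) ^ (2 k)`. -/
theorem two_pow_blocks_le {W : Type*} [AddCommGroup W] [Module ℝ W] [FiniteDimensional ℝ W]
    (N : Seminorm ℝ W) (hN : ∀ v, N v = 0 → v = 0) {ε : ℝ} (hε : 0 < ε) (hε1 : ε ≤ 1)
    {n d B t : ℕ} (hB0 : 0 < B) (hB : (64 * ε) ^ 2 * B < 1) (hd : B * t ≤ d)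
    (hn : 2 * (B * 5 ^ t) ≤ n) [Infinite (EuclideanSpace ℝ (Fin d))]
    (H : ∀ X : Finset (EuclideanSpace ℝ (Fin d)), X.card = n →
      ∃ f : {x : EuclideanSpace ℝ (Fin d) // x ∈ X} → W,
        ∀ x y : {x : EuclideanSpace ℝ (Fin d) // x ∈ X},
          (1 - ε) * ‖(x : EuclideanSpace ℝ (Fin d)) - (y : EuclideanSpace ℝ (Fin d))‖
            ≤ N (f x - f y) ∧
          N (f x - f y)
            ≤ (1 + ε) * ‖(x : EuclideanSpace ℝ (Fin d)) - (y : EuclideanSpace ℝ (Fin d))‖) :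
    (2 : ℝ) ^ (B * t) ≤ ((9 / ε) ^ finrank ℝ W) ^ 2 := by
  obtain ⟨P, hP, hsep, hnet⟩ := exists_separated_net (EuclideanSpace ℝ (Fin t))
    (R := 1) (s := 1 / 2) (by norm_num) (by norm_num)
  have hup := card_le_of_norm_separated (by norm_num) (by norm_num) P hP hsep
  have hlow := le_card_of_net (by norm_num) (by norm_num) P hnet
  norm_num [finrank_euclideanSpace] at hup hlow
  have hup' : P.card ≤ 5 ^ t := by exact_mod_cast hup
  have hfin : finrank ℝ (PiLp 2 (fun _ : Fin B => EuclideanSpace ℝ (Fin t))) ≤ d := by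
    rw [(WithLp.linearEquiv 2 ℝ (Fin B → EuclideanSpace ℝ (Fin t))).finrank_eq, finrank_pi_fintype]
    simpa using hd
  obtain ⟨J⟩ := exists_linearIsometry_euclideanSpace hfin
  obtain ⟨p, hp, -⟩ := hnet 0 (by simp)
  have : Nonempty (Fin B × P) := ⟨(⟨0, hB0⟩, ⟨p, hp⟩)⟩
  have hcard : Fintype.card ((Fin B × P) ⊕ (Fin B × P)) ≤ n := by
    simp only [Fintype.card_sum, Fintype.card_prod, Fintype.card_fin, Fintype.card_coe]
    have := Nat.mul_le_mul_left B hup'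
    omega
  have hwords := card_words_le N hN hε hε1 (blockBase P B) (blockWord P B)
    (norm_blockBase_le hP) (norm_blockWord_le hP)
    (exists_blockBase_separating hP hsep hnet hε hB) (fun g => by
      obtain ⟨f, hf⟩ := exists_embedding_of_family H hcard (fun i => J (g i))
      refine ⟨f, fun i j => ?_⟩
      have := hf i j
      rwa [← map_sub, J.norm_map] at this)
  refine le_trans ?_ hwords
  simp only [Fintype.card_fun, Fintype.card_fin, Fintype.card_coe, Nat.cast_pow]
  rw [mul_comm, pow_mul]
  gcongr

/-! ### Parameters and the bound for small distortion. -/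

open Real in
/-- Choice of the number of blocks and of their dimension. -/
theorem exists_block_parameters {ε : ℝ} (hε : 0 < ε) (hε1 : ε ≤ 1 / 100) {n d : ℕ}
    (hn : 1 < ε ^ 2 * n) (hd : log n < ε ^ 2 * d) :
    ∃ B t : ℕ, 0 < B ∧ (64 * ε) ^ 2 * B < 1 ∧ B * t ≤ d ∧ 2 * (B * 5 ^ t) ≤ n ∧
      1 ≤ 10000 * ε ^ 2 * B ∧ log (ε ^ 2 * n) ≤ t * log 5 := by
  have hε2 : 0 < ε ^ 2 := by positivity
  have hε3 : ε ^ 2 ≤ 1 / 10000 := by nlinarith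
  have hlog5 : 1 ≤ log 5 := by
    rw [le_log_iff_exp_le (by norm_num)]
    linarith [exp_one_lt_d9]
  have hn0 : (0 : ℝ) < n := by
    by_contra! h
    nlinarith
  have hn1 : (10000 : ℝ) ≤ n := by
    by_contra! h
    nlinarith
  have hlogn : 1 ≤ log n := by
    rw [le_log_iff_exp_le hn0]
    linarith [exp_one_lt_d9]
  have hlog0 : 0 ≤ log (ε ^ 2 * n) := log_nonneg hn.le
  have hlogle : log (ε ^ 2 * n) ≤ log n := log_le_log (by linarith) (by nlinarith)
  set x := log (ε ^ 2 * n) / log 5 with hx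
  have hx0 : 0 ≤ x := by positivity
  have hxlog : x ≤ log n := (div_le_self hlog0 hlog5).trans hlogle
  have hxmul : x * log 5 = log (ε ^ 2 * n) := div_mul_cancel₀ _ (by linarith)
  -- `5000 > 64²` gives the separation condition; `y ≥ 2` ensures that taking the floor loses at
  -- most a factor 2.
  set y := 1 / (5000 * ε ^ 2) with hy
  have hy1 : 2 ≤ y := by
    rw [hy, le_div_iff₀ (by positivity)]
    linarith
  have hyε : ε ^ 2 * y = 1 / 5000 := by
    rw [hy]
    field_simp
  have hfx := Nat.floor_le hx0
  have hfy := Nat.floor_le (by linarith : 0 ≤ y)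
  have hfx' := Nat.lt_floor_add_one x
  have hfy' := Nat.lt_floor_add_one y
  have hεB : ε ^ 2 * ⌊y⌋₊ ≤ 1 / 5000 := hyε ▸ mul_le_mul_of_nonneg_left hfy hε2.le
  refine ⟨⌊y⌋₊, ⌊x⌋₊ + 1, Nat.floor_pos.2 (by linarith), ?_, ?_, ?_, ?_, ?_⟩
  · nlinarith
  · rw [← Nat.cast_le (α := ℝ)]
    push_cast
    -- The lower bound on `d` is what makes room for all blocks.
    have h1 : ε ^ 2 * (⌊y⌋₊ * (⌊x⌋₊ + 1)) ≤ 1 / 5000 * (2 * log n) := by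
      rw [← mul_assoc]
      gcongr
      linarith
    nlinarith
  · rw [← Nat.cast_le (α := ℝ)]
    push_cast
    have h5 : (5 : ℝ) ^ ⌊x⌋₊ ≤ ε ^ 2 * n := by
      rw [← log_le_log_iff (by positivity) (by linarith), log_pow, ← hxmul]
      gcongr
    have h6 : (⌊y⌋₊ : ℝ) * 5 ^ ⌊x⌋₊ ≤ ⌊y⌋₊ * (ε ^ 2 * n) := by gcongr
    rw [pow_succ]
    nlinarith
  · nlinarith
  · push_cast
    rw [← hxmul]
    gcongr

open Real in
/-- The lower bound for small distortion. -/
theorem dimension_lower_bound_of_small {ε : ℝ} (hε : 0 < ε) (hε1 : ε ≤ 1 / 100) {n d k : ℕ}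
    (hd1 : 1 ≤ d) (hn : 1 < ε ^ 2 * n) (hd : log n < ε ^ 2 * d)
    (N : Seminorm ℝ (Fin k → ℝ)) (hN : ∀ v : Fin k → ℝ, N v = 0 → v = 0)
    (H : ∀ X : Finset (EuclideanSpace ℝ (Fin d)), X.card = n →
      ∃ f : {x : EuclideanSpace ℝ (Fin d) // x ∈ X} → (Fin k → ℝ),
        ∀ x y : {x : EuclideanSpace ℝ (Fin d) // x ∈ X},
          (1 - ε) * ‖(x : EuclideanSpace ℝ (Fin d)) - (y : EuclideanSpace ℝ (Fin d))‖
            ≤ N (f x - f y) ∧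
          N (f x - f y)
            ≤ (1 + ε) * ‖(x : EuclideanSpace ℝ (Fin d)) - (y : EuclideanSpace ℝ (Fin d))‖) :
    log (ε ^ 2 * n) ≤ 160000 * k * (ε ^ 2 * log (1 / ε)) := by
  obtain ⟨B, t, hB0, hB, hBt, hBn, hBε, ht⟩ := exists_block_parameters hε hε1 hn hd
  have : NeZero d := ⟨by omega⟩
  have : Infinite (EuclideanSpace ℝ (Fin d)) := Module.Free.infinite ℝ _
  have hpow := two_pow_blocks_le N hN hε (by linarith) hB0 hB hBt hBn H
  rw [Module.finrank_fin_fun] at hpow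
  have hlog := log_le_log (by positivity) hpow
  rw [log_pow, log_pow, log_pow] at hlog
  push_cast at hlog
  -- `9/ε ≤ ε⁻²` because `ε ≤ 1/9`.
  have h9 : log (9 / ε) ≤ 2 * log (1 / ε) := by
    rw [← Nat.cast_ofNat (R := ℝ) (n := 2), ← log_pow]
    refine log_le_log (by positivity) ?_
    rw [div_pow, div_le_div_iff₀ hε (by positivity)]
    nlinarith
  have h5 : log 5 ≤ 4 * log 2 := by
    rw [← Nat.cast_ofNat (R := ℝ) (n := 4), ← log_pow]
    exact log_le_log (by norm_num) (by norm_num)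
  have hk : (0 : ℝ) ≤ k := k.cast_nonneg
  have hmain : (B : ℝ) * t * log 2 ≤ 4 * k * log (1 / ε) := by nlinarith
  have ht' : log (ε ^ 2 * n) ≤ 4 * (t * log 2) := by nlinarith [(t.cast_nonneg : (0 : ℝ) ≤ t)]
  have hT : 0 ≤ t * log 2 := by positivity
  calc log (ε ^ 2 * n) ≤ 4 * (t * log 2) := ht'
    _ ≤ 4 * (10000 * ε ^ 2 * B * (t * log 2)) := by nlinarith
    _ = 40000 * ε ^ 2 * (B * t * log 2) := by ring
    _ ≤ 40000 * ε ^ 2 * (4 * k * log (1 / ε)) := by gcongr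
    _ = _ := by ring

/-! ### Packing bound for large distortion. -/

open Real in
/-- Packing lower bound, valid for every distortion below `1`. -/
theorem log_le_of_embeds {ε : ℝ} (hε : 0 < ε) (hε1 : ε < 1) {n d k : ℕ}
    (hd1 : 1 ≤ d) (hn1 : 1 ≤ n) (hd : log n ≤ d)
    (N : Seminorm ℝ (Fin k → ℝ)) (hN : ∀ v : Fin k → ℝ, N v = 0 → v = 0)
    (H : ∀ X : Finset (EuclideanSpace ℝ (Fin d)), X.card = n →
      ∃ f : {x : EuclideanSpace ℝ (Fin d) // x ∈ X} → (Fin k → ℝ),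
        ∀ x y : {x : EuclideanSpace ℝ (Fin d) // x ∈ X},
          (1 - ε) * ‖(x : EuclideanSpace ℝ (Fin d)) - (y : EuclideanSpace ℝ (Fin d))‖
            ≤ N (f x - f y) ∧
          N (f x - f y)
            ≤ (1 + ε) * ‖(x : EuclideanSpace ℝ (Fin d)) - (y : EuclideanSpace ℝ (Fin d))‖) :
    log 2 * log n ≤ k * log (17 / (1 - ε)) := by
  classical
  obtain ⟨P, hP, hsep, hnet⟩ := exists_separated_net (EuclideanSpace ℝ (Fin d))
    (R := 1) (s := 1 / 2) (by norm_num) (by norm_num)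
  have hlow := le_card_of_net (by norm_num) (by norm_num) P hnet
  norm_num [finrank_euclideanSpace] at hlow
  have hPpos : 0 < P.card := by
    have : (0 : ℝ) < P.card := lt_of_lt_of_le (by positivity) hlow
    exact_mod_cast this
  obtain ⟨Q, hQP, hQ⟩ := Finset.exists_subset_card_eq (min_le_right n P.card)
  have : NeZero d := ⟨by omega⟩
  have : Infinite (EuclideanSpace ℝ (Fin d)) := Module.Free.infinite ℝ _
  obtain ⟨f, hf⟩ := exists_embedding_of_family H (ι := Q)
    (by rw [Fintype.card_coe, hQ]; exact min_le_left _ _) (fun q => (q : EuclideanSpace ℝ (Fin d)))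
  have hε' : 0 < 1 - ε := by linarith
  have hfsep : ∀ x y : Q, x ≠ y → (1 - ε) / 2 ≤ N (f x - f y) := fun x y hxy => by
    have h1 := hsep _ (hQP x.2) _ (hQP y.2) (fun h => hxy (Subtype.ext h))
    have h2 := (hf x y).1
    nlinarith
  have hinj : Function.Injective f := fun x y hxy => by
    by_contra hne
    have := hfsep x y hne
    rw [hxy, sub_self, map_zero] at this
    linarith
  have hQpos : 0 < Q.card := by
    rw [hQ]
    omega
  obtain ⟨x₀, hx₀⟩ := Finset.card_pos.1 hQpos
  have hcard := N.card_le_of_separated hN (R := 4) (s := (1 - ε) / 2) (by norm_num) (by linarith)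
    (Finset.univ.image fun x => f x - f ⟨x₀, hx₀⟩) (by
      intro v hv
      obtain ⟨x, -, rfl⟩ := Finset.mem_image.1 hv
      have h1 := (hf x ⟨x₀, hx₀⟩).2
      have h2 := norm_sub_le (x : EuclideanSpace ℝ (Fin d)) x₀
      have h3 := hP _ (hQP x.2)
      have h4 := hP _ (hQP hx₀)
      have h5 := norm_nonneg ((x : EuclideanSpace ℝ (Fin d)) - x₀)
      simp only at h1
      nlinarith) (by
      intro v hv v' hv' hne
      obtain ⟨x, -, rfl⟩ := Finset.mem_image.1 hv
      obtain ⟨y, -, rfl⟩ := Finset.mem_image.1 hv'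
      rw [sub_sub_sub_cancel_right]
      exact hfsep x y fun h => hne (by rw [h]))
  rw [Finset.card_image_of_injective _ (fun x y h => hinj (sub_left_injective h)),
    Finset.card_univ, Fintype.card_coe, Module.finrank_fin_fun] at hcard
  have hcard' : (Q.card : ℝ) ≤ (17 / (1 - ε)) ^ k := by
    refine hcard.trans (pow_le_pow_left₀ (by positivity) ?_ _)
    rw [le_div_iff₀ hε']
    have : 2 * 4 / ((1 - ε) / 2) * (1 - ε) = 16 := by
      field_simp
      norm_num
    rw [add_mul, this]
    linarith
  have hlog := log_le_log (by exact_mod_cast hQpos) hcard'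
  rw [log_pow] at hlog
  refine le_trans ?_ hlog
  have hlog2 : 0 < log 2 := log_pos (by norm_num)
  have hlog2' : log 2 ≤ 1 := by linarith [log_two_lt_d9]
  have hlogn : 0 ≤ log (n : ℝ) := log_natCast_nonneg n
  -- Either `|Q| = n`, and `log 2 ≤ 1` suffices, or `|Q| = |P| ≥ 2^d` with `d ≥ log n`.
  rcases le_total n P.card with h | h
  · rw [hQ, min_eq_left h]
    nlinarith
  · rw [hQ, min_eq_right h]
    have := log_le_log (by positivity) hlow
    rw [log_pow] at this
    nlinarith

/-! ### Combining the two regimes. -/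

theorem theorem1p2 :
    ∀ ε₀ : ℝ, ε₀ < 1 → ∃ c : ℝ, 0 < c ∧
      ∀ (n d k : ℕ), 1 ≤ n → 1 ≤ d →
      ∀ N : Seminorm ℝ (Fin k → ℝ), (∀ v : Fin k → ℝ, N v = 0 → v = 0) →
      ∀ ε : ℝ, Real.sqrt (Real.log (n : ℝ)) / Real.sqrt (d : ℝ) < ε → ε ≤ ε₀ →
        (∀ X : Finset (EuclideanSpace ℝ (Fin d)), X.card = n →
          ∃ f : {x : EuclideanSpace ℝ (Fin d) // x ∈ X} → (Fin k → ℝ),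
            ∀ x y : {x : EuclideanSpace ℝ (Fin d) // x ∈ X},
              (1 - ε) * ‖(x : EuclideanSpace ℝ (Fin d)) - (y : EuclideanSpace ℝ (Fin d))‖
                  ≤ N (f x - f y) ∧
              N (f x - f y)
                  ≤ (1 + ε) * ‖(x : EuclideanSpace ℝ (Fin d)) - (y : EuclideanSpace ℝ (Fin d))‖) →
        c * (Real.log (ε ^ 2 * (n : ℝ)) / (ε ^ 2 * Real.log (1 / ε))) ≤ (k : ℝ) := by
  intro ε₀ hε₀
  -- For `ε₀ ≤ 0` no `ε` is admissible.
  rcases le_or_gt ε₀ 0 with hneg | hpos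
  · refine ⟨1, one_pos, fun n d k _ _ N _ ε hlo hhi => ?_⟩
    have : 0 ≤ Real.sqrt (Real.log (n : ℝ)) / Real.sqrt (d : ℝ) := by positivity
    linarith
  have hlog0 : 0 < Real.log (1 / ε₀) := Real.log_pos (by rw [lt_div_iff₀ hpos]; linarith)
  have hlog17 : 0 < Real.log (17 / (1 - ε₀)) :=
    Real.log_pos (by rw [lt_div_iff₀ (by linarith)]; linarith)
  have hlog2 : 0 < Real.log 2 := Real.log_pos (by norm_num)
  let c₁ := Real.log 2 * (1 / 10000 * Real.log (1 / ε₀)) / Real.log (17 / (1 - ε₀))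
  have hc₁ : 0 < c₁ := by positivity
  refine ⟨min (1 / 160000) c₁, lt_min (by norm_num) hc₁, ?_⟩
  intro n d k hn1 hd1 N hN ε hlo hhi H
  have hε : 0 < ε := lt_of_le_of_lt (by positivity) hlo
  have hε1 : ε < 1 := by linarith
  have hlogε : 0 < Real.log (1 / ε) := Real.log_pos (by rw [lt_div_iff₀ hε]; linarith)
  have hden : 0 < ε ^ 2 * Real.log (1 / ε) := by positivity
  have hk : (0 : ℝ) ≤ k := k.cast_nonneg
  have hn0 : (0 : ℝ) < n := by exact_mod_cast hn1
  have hd0 : (0 : ℝ) < d := by exact_mod_cast hd1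
  -- Here the logarithm is nonpositive and the bound is trivial.
  rcases le_or_gt (ε ^ 2 * (n : ℝ)) 1 with hsmall | hbig
  · refine le_trans (mul_nonpos_of_nonneg_of_nonpos (le_min (by norm_num) hc₁.le) ?_) hk
    exact div_nonpos_of_nonpos_of_nonneg (Real.log_nonpos (by positivity) hsmall) hden.le
  have hlog : 0 < Real.log (ε ^ 2 * n) := Real.log_pos hbig
  have hd : Real.log n < ε ^ 2 * d := by
    rw [← Real.sqrt_div' _ hd0.le, Real.sqrt_lt' hε, div_lt_iff₀ hd0] at hlo
    exact hlo
  rw [← mul_div_assoc, div_le_iff₀ hden]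
  rcases le_or_gt ε (1 / 100) with hε2 | hε2
  · have := dimension_lower_bound_of_small hε hε2 hd1 hbig hd N hN H
    have := mul_le_mul_of_nonneg_right (min_le_left (1 / 160000) c₁) hlog.le
    linarith
  · have hεsq : ε ^ 2 ≤ 1 := pow_le_one₀ hε.le hε1.le
    have hpack := log_le_of_embeds hε hε1 hd1 hn1
      (hd.le.trans (mul_le_of_le_one_left hd0.le hεsq)) N hN H
    have h1 : Real.log (17 / (1 - ε)) ≤ Real.log (17 / (1 - ε₀)) := by
      refine Real.log_le_log (div_pos (by norm_num) (by linarith)) ?_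
      gcongr
    have h2 : Real.log (1 / ε₀) ≤ Real.log (1 / ε) := by
      refine Real.log_le_log (by positivity) ?_
      gcongr
    have h3 : Real.log (ε ^ 2 * n) ≤ Real.log n := Real.log_le_log (by positivity)
      (mul_le_of_le_one_left hn0.le hεsq)
    -- Uses `ε > 1/100`; this is the source of the constant in `c₁`.
    have h4 : 1 / 10000 * Real.log (1 / ε₀) ≤ ε ^ 2 * Real.log (1 / ε) := by
      gcongr
      nlinarith
    have h5 : Real.log 2 * Real.log n ≤ k * Real.log (17 / (1 - ε₀)) :=
      hpack.trans (by gcongr)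
    calc min (1 / 160000) c₁ * Real.log (ε ^ 2 * n) ≤ c₁ * Real.log n := by
          gcongr
          exact min_le_right _ _
      _ = Real.log 2 * Real.log n * (1 / 10000 * Real.log (1 / ε₀)) /
            Real.log (17 / (1 - ε₀)) := by
          simp only [c₁]
          ring
      _ ≤ k * Real.log (17 / (1 - ε₀)) * (1 / 10000 * Real.log (1 / ε₀)) /
            Real.log (17 / (1 - ε₀)) := by gcongr
      _ = k * (1 / 10000 * Real.log (1 / ε₀)) := by
          field_simp
      _ ≤ k * (ε ^ 2 * Real.log (1 / ε)) := by gcongr
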